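/- Let $\mathcal A$ be a finite set of scenarios, let $\ell:\mathcal A\times\mathcal A\to\mathbb R_{\ge0}$ satisfy $\ell(A,A)=0$ for all $A$ (for instance a metric), and let $r\ge0$. For distributions $p,q$ on $\mathcal A$ let $L_W(p,q)$ be the Wasserstein distance: the minimum of $\sum_{A,A'}\gamma_{A,A'}\,\ell(A,A')$ over all $\gamma\ge0$ with $\sum_{A'}\gamma_{A,A'}=p_A$ for all $A$ and $\sum_{A}\gamma_{A,A'}=q_{A'}$ for all $A'$. Let $\mathcal P\subseteq\mathbb R_{\ge0}^m$ be a polytope, $c\in\mathbb R^m$, and let $g(x,A)\in\mathbb R$ be given for $x\in\mathcal P$, $A\in\mathcal A$. For a distribution $p$ and $x\in\mathcal P$ put $$h(p;x)=c^{\mathsf T}x+\max_{q:\,L_W(p,q)\le r}\ \mathbb E_{A\sim q}[g(x,A)].$$ Assume, for all $x\in\mathcal P$ and $A,A'\in\mathcal A$ ($\|\cdot\|$ is the Euclidean norm): (P1) $0\in\mathcal P$, $c\ge0$, and $0\le g(x,A)\le g(0,A)$; (P2) $g(0,A)\le g(x,A)+\lambda\,c^{\mathsf T}x$, where $\lambda\ge1$;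 (P3) $\mathcal P\subseteq\{x:\|x\|\le R\}$ and $\mathcal P$ contains a ball of radius $V$, where $R>0$ and $0<V\le1$; (P4) $g(\cdot,A)$ is convex on $\mathcal P$; (P5) there is $s\in\mathbb R^m$ with $\|s\|\le K$ and $g(v,A)-g(x,A)\ge s\cdot(v-x)$ for all $v\in\mathcal P$; (P6) $g(x,A')-g(x,A)\le\tau\,\ell(A,A')$ whenever $\ell(A,A')>0$, where $\tau\ge1$. Let $\mathrm{LB}>0$ satisfy $\mathrm{LB}\le\min_{x\in\mathcal P}h(p;x)$ for every distribution $p$ on $\mathcal A$. Let $0<\varepsilon\le\frac13$, $0<\delta<1$ and $k=\bigl\lceil\frac2\varepsilon\ln\frac1\delta\bigr\rceil$. There are absolute constants $C,B,D$ (independent of everything else) such that the following holds for every such problem, every distribution $\mathring p$ on $\mathcal A$ and every integer $$N\ \ge\ B\Bigl(\tfrac{\lambda}{\varepsilon}+\ln^{+}\tfrac{\tau R}{V\cdot\mathrm{LB}}+\ln\tfrac1\delta+m+\ln^{+}K\Bigr)^{D},\qquad \ln^+t=\max\{0,\ln t\}.$$ Let $\hat p^1,\dots,\hat p^k$ be the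 empirical distributions of $k$ batches of $N$ samples from $\mathring p$, all $kN$ samples being independent. Let $\bar\beta,\rho\ge1$, and suppose that for every $i=1,\dots,k$ we have (possibly depending on the samples) a point $\bar x^i\in\mathcal P$ and a number $\bar f^i$ with $$h(\hat p^i;\bar x^i)\le\bar\beta\,\bar f^i\qquad\text{and}\qquad \bar f^i\le\rho\cdot\min_{x\in\mathcal P}h(\hat p^i;x).$$ Let $j\in\arg\min_{i}\bar f^i$ and $\bar x=\bar x^j$. Then, with probability at least $1-3\delta$, $$h(\mathring p;\bar x)\ \le\ 4\bar\beta\rho\,(1+C\varepsilon)\cdot\min_{x\in\mathcal P}h(\mathring p;x).$$ -/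

import Mathlib

open Real MeasureTheory ProbabilityTheory

noncomputable section

namespace DRTwoStage

/-- Transportation plans (flows) from `p` to `q`: nonnegative arrays `γ` on `𝒜 × 𝒜` whose first
marginal is `p` and whose second marginal is `q`. -/
def transportPlans {𝒜 : Type*} [Fintype 𝒜] (p q : 𝒜 → ℝ) : Set (𝒜 → 𝒜 → ℝ) :=
  {γ | (∀ A A', 0 ≤ γ A A') ∧ (∀ A, ∑ A', γ A A' = p A) ∧ (∀ A', ∑ A, γ A A' = q A')}

/-- The Wasserstein distance from `p` to `q` with respect to the scenario distance `ℓ`: the least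
cost of a transportation plan. -/
def wassersteinDist {𝒜 : Type*} [Fintype 𝒜] (ℓ : 𝒜 → 𝒜 → ℝ) (p q : 𝒜 → ℝ) : ℝ :=
  sInf ((fun γ : 𝒜 → 𝒜 → ℝ => ∑ A, ∑ A', γ A A' * ℓ A A') '' transportPlans p q)

/-- `s` is a subgradient of `f` at `u`, relative to the set `S`. -/
def IsSubgradientOn {m : ℕ} (f : EuclideanSpace ℝ (Fin m) → ℝ)
    (S : Set (EuclideanSpace ℝ (Fin m))) (s u : EuclideanSpace ℝ (Fin m)) : Prop :=
  ∀ v ∈ S, inner ℝ s (v - u) ≤ f v - f u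

/-- Data of a fractional distributionally robust two-stage problem with `m` first-stage variables
and scenario set `𝒜`. Only the values `recourse x A` with `x ∈ feasible` matter. -/
structure Problem (m : ℕ) (𝒜 : Type*) where
  /-- the set `P` of fractional first-stage decisions -/
  feasible : Set (EuclideanSpace ℝ (Fin m))
  /-- the first-stage cost vector `c` -/
  cost : EuclideanSpace ℝ (Fin m)
  /-- the optimal second-stage cost `g(x, A)` -/
  recourse : EuclideanSpace ℝ (Fin m) → 𝒜 → ℝ
  /-- the scenario distance `ℓ(A, A')` -/
  scenarioDist : 𝒜 → 𝒜 → ℝ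
  /-- the radius `r` of the Wasserstein ball -/
  radius : ℝ

namespace Problem

variable {m : ℕ} {𝒜 : Type*}

/-- First-stage cost `cᵀ x`. -/
def firstStage (Q : Problem m 𝒜) (x : EuclideanSpace ℝ (Fin m)) : ℝ :=
  ∑ i, Q.cost i * x i

/-- The Wasserstein ball of distributions of radius `r` around `p`. -/
def ball [Fintype 𝒜] (Q : Problem m 𝒜) (p : 𝒜 → ℝ) : Set (𝒜 → ℝ) :=
  {q | q ∈ stdSimplex ℝ 𝒜 ∧ wassersteinDist Q.scenarioDist p q ≤ Q.radius}

/-- Worst-case expected second-stage cost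
`z(p; x) = max_{q : L_W(p, q) ≤ r} E_{A ∼ q} [g(x, A)]`. -/
def worstCase [Fintype 𝒜] (Q : Problem m 𝒜) (p : 𝒜 → ℝ) (x : EuclideanSpace ℝ (Fin m)) : ℝ :=
  sSup ((fun q : 𝒜 → ℝ => ∑ A, q A * Q.recourse x A) '' Q.ball p)

/-- The objective function `h(p; x) = cᵀ x + z(p; x)` for the central distribution `p`. -/
def objective [Fintype 𝒜] (Q : Problem m 𝒜) (p : 𝒜 → ℝ) (x : EuclideanSpace ℝ (Fin m)) : ℝ :=
  Q.firstStage x + Q.worstCase p x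

/-- The optimal value `min_{x ∈ P} h(p; x)`. -/
def optValue [Fintype 𝒜] (Q : Problem m 𝒜) (p : 𝒜 → ℝ) : ℝ :=
  sInf (Q.objective p '' Q.feasible)

/-- The standing assumptions on the data together with properties (P1)-(P6), for the inflation
parameter `lam` and the bounds `R`, `V`, `K`, `τ`. -/
structure Admissible (Q : Problem m 𝒜) (lam R V K τ : ℝ) : Prop where
  /-- `P` is a polytope -/
  polytope : ∃ s : Set (EuclideanSpace ℝ (Fin m)), s.Finite ∧ Q.feasible = convexHull ℝ s
  /-- `P` lies in the nonnegative orthant -/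
  feasible_nonneg : ∀ x ∈ Q.feasible, ∀ i, 0 ≤ x i
  /-- `ℓ` is nonnegative -/
  dist_nonneg : ∀ A A', 0 ≤ Q.scenarioDist A A'
  /-- `ℓ` vanishes on the diagonal; neither symmetry nor the triangle inequality is needed -/
  dist_self : ∀ A, Q.scenarioDist A A = 0
  /-- the radius is nonnegative -/
  radius_nonneg : 0 ≤ Q.radius
  /-- (P1): `0 ∈ P` -/
  zero_mem : 0 ∈ Q.feasible
  /-- (P1): `c ≥ 0` -/
  cost_nonneg : ∀ i, 0 ≤ Q.cost i
  /-- (P1): `g(x, A) ≥ 0` -/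
  recourse_nonneg : ∀ x ∈ Q.feasible, ∀ A, 0 ≤ Q.recourse x A
  /-- (P1): `g(x, A) ≤ g(0, A)` -/
  recourse_le_zero : ∀ x ∈ Q.feasible, ∀ A, Q.recourse x A ≤ Q.recourse 0 A
  /-- (P2): `lam ≥ 1` -/
  one_le_lam : 1 ≤ lam
  /-- (P2): `g(0, A) ≤ g(x, A) + lam cᵀ x` -/
  inflation : ∀ x ∈ Q.feasible, ∀ A, Q.recourse 0 A ≤ Q.recourse x A + lam * Q.firstStage x
  /-- (P3): `R > 0` -/
  R_pos : 0 < R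
  /-- (P3): `V > 0` -/
  V_pos : 0 < V
  /-- (P3): `V ≤ 1` -/
  V_le_one : V ≤ 1
  /-- (P3): `P` is contained in the ball of radius `R` around `0` -/
  feasible_subset : Q.feasible ⊆ Metric.closedBall 0 R
  /-- (P3): `P` contains a ball of radius `V` -/
  ball_subset : ∃ z, Metric.closedBall z V ⊆ Q.feasible
  /-- (P4): `g(·, A)` is convex over `P` -/
  convex : ∀ A, ConvexOn ℝ Q.feasible (fun x => Q.recourse x A)
  /-- (P5): `g(·, A)` has a subgradient of norm at most `K` at each point of `P` -/
  subgradient : ∀ x ∈ Q.feasible, ∀ A, ∃ s : EuclideanSpace ℝ (Fin m),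
    IsSubgradientOn (fun v => Q.recourse v A) Q.feasible s x ∧ ‖s‖ ≤ K
  /-- (P6): `τ ≥ 1` -/
  one_le_tau : 1 ≤ τ
  /-- (P6): `g(x, A') - g(x, A) ≤ τ ℓ(A, A')` whenever `ℓ(A, A') > 0` -/
  recourse_sub_le : ∀ x ∈ Q.feasible, ∀ A A', 0 < Q.scenarioDist A A' →
    Q.recourse x A' - Q.recourse x A ≤ τ * Q.scenarioDist A A'

end Problem

/-- The empirical distribution of a list of `N` scenarios. -/
def empirical {𝒜 : Type*} {N : ℕ} (a : Fin N → 𝒜) (A : 𝒜) : ℝ :=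
  (Nat.card {n : Fin N // a n = A} : ℝ) / N

end DRTwoStage

end

/-!
The proof works with the Lagrangian dual of the worst-case expectation,
`z(p; u) = min_{y ≥ 0} (r y + E_{A ∼ p} [max_{A'} (u A' - y ℓ(A, A'))])`
(`worstExp_le_lagrangian`, `exists_lagrangian_le_worstExp`), in which the central distribution `p`
enters linearly, so that empirical means can be compared with expectations. Let `xs` be a
nearly optimal decision for the true distribution `p` and `W = h(p; xs)`.

*Upper bound at `xs`.* With the multiplier optimal for `p`, weak duality bounds the empirical
objective at `xs` by an empirical mean with expectation `W`. By Markov's inequality a batch exceeds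
`(1 + ε) W` with probability at most `1 / (1 + ε)`, and the `k` batches are independent, so some
batch satisfies `h(p̂; xs) ≤ (1 + ε) W` with probability at least `1 - δ`
(`measure_not_exists_objective_le`).

*Lower bound, uniform in `x`.* Call a scenario high if `g(0, A) > M = 2 lam W / ε`. By the inflation
property every transportation plan from `p` moves mass at most `ε / lam` to high scenarios, whose
contribution is therefore at most `W`, whatever `x` is
(`Problem.Admissible.worstCase_le_lowRecourse`). The low scenarios have recourse costs in `[0, M]`,
so Hoeffding's inequality applies to the Lagrangian at each decision and multiplier. The union bound
runs over a grid of decisions (`exists_net`) and a grid of multipliers of size about `M / (ε W)`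
(`exists_multiplier_grid`): only multipliers with `r y ≤ M` matter, and rounding one up decreases
the Lagrangian. With probability at least `1 - δ` this gives `h(p; x) ≤ h(p̂; x) + (1 + 4 ε) W` for
all batches and all feasible `x` (`measure_not_forall_objective_le`).

On both events the decision with the least estimate costs at most
`β ρ (1 + ε) W + (1 + 4 ε) W ≤ β ρ (2 + 5 ε) W`, which is within the factor `4 β ρ (1 + ε)` of the
optimum since `ε ≤ 1 / 3`. The decisions and estimates need not be measurable in the outcome: the
events used depend on the samples only.
-/

namespace DRTwoStage

/-! ### Worst-case expectations and Lagrangian duality -/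

section Duality

variable {𝒜 : Type*} [Fintype 𝒜]

/-- The largest expectation of `u` over the Wasserstein ball of radius `r` around `p`.
`Problem.worstCase Q p x` is the case `u = Q.recourse x`. -/
noncomputable def worstExp (ℓ : 𝒜 → 𝒜 → ℝ) (r : ℝ) (p u : 𝒜 → ℝ) : ℝ :=
  sSup ((fun q : 𝒜 → ℝ => ∑ A, q A * u A) ''
    {q | q ∈ stdSimplex ℝ 𝒜 ∧ wassersteinDist ℓ p q ≤ r})

/-- Transportation plans with first marginal `p` (the second marginal is free) and cost at most
`r`. -/
def budgetPlans (ℓ : 𝒜 → 𝒜 → ℝ) (r : ℝ) (p : 𝒜 → ℝ) : Set (𝒜 → 𝒜 → ℝ) :=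
  {γ | (∀ A A', 0 ≤ γ A A') ∧ (∀ A, ∑ A', γ A A' = p A) ∧ ∑ A, ∑ A', γ A A' * ℓ A A' ≤ r}

/-- The scenario-wise Lagrangian `max_{A'} (u A' - y ℓ(A, A'))` of the worst-case expectation, with
multiplier `y` for the bound on the transportation cost. -/
noncomputable def lagrangian (ℓ : 𝒜 → 𝒜 → ℝ) (y : ℝ) (u : 𝒜 → ℝ) (A : 𝒜) : ℝ :=
  ⨆ A', (u A' - y * ℓ A A')

lemma sub_le_lagrangian (ℓ : 𝒜 → 𝒜 → ℝ) (y : ℝ) (u : 𝒜 → ℝ) (A A' : 𝒜) :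
    u A' - y * ℓ A A' ≤ lagrangian ℓ y u A :=
  le_ciSup (f := fun A' => u A' - y * ℓ A A') (Set.finite_range _).bddAbove A'

lemma exists_eq_lagrangian (ℓ : 𝒜 → 𝒜 → ℝ) (y : ℝ) (u : 𝒜 → ℝ) (A : 𝒜) :
    ∃ A', u A' - y * ℓ A A' = lagrangian ℓ y u A :=
  haveI : Nonempty 𝒜 := ⟨A⟩
  exists_eq_ciSup_of_finite

lemma le_lagrangian_self {ℓ : 𝒜 → 𝒜 → ℝ} (hd : ∀ A, ℓ A A = 0) (y : ℝ) (u : 𝒜 → ℝ) (A : 𝒜) :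
    u A ≤ lagrangian ℓ y u A := by
  simpa [hd A] using sub_le_lagrangian ℓ y u A A

lemma lagrangian_le {ℓ : 𝒜 → 𝒜 → ℝ} (hℓ : ∀ A A', 0 ≤ ℓ A A') {y M : ℝ} (hy : 0 ≤ y)
    {u : 𝒜 → ℝ} (hu : ∀ A, u A ≤ M) (A : 𝒜) : lagrangian ℓ y u A ≤ M := by
  obtain ⟨A', h⟩ := exists_eq_lagrangian ℓ y u A
  rw [← h]
  linarith [mul_nonneg hy (hℓ A A'), hu A']

lemma lagrangian_anti {ℓ : 𝒜 → 𝒜 → ℝ} (hℓ : ∀ A A', 0 ≤ ℓ A A') {y y' : ℝ} (hy : y ≤ y')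
    (u : 𝒜 → ℝ) (A : 𝒜) : lagrangian ℓ y' u A ≤ lagrangian ℓ y u A := by
  obtain ⟨A', h⟩ := exists_eq_lagrangian ℓ y' u A
  rw [← h]
  linarith [sub_le_lagrangian ℓ y u A A', mul_le_mul_of_nonneg_right hy (hℓ A A')]

lemma nonempty_of_mem_stdSimplex {p : 𝒜 → ℝ} (hp : p ∈ stdSimplex ℝ 𝒜) : Nonempty 𝒜 := by
  by_contra h
  rw [not_nonempty_iff] at h
  simpa using hp.2

lemma sum_mul_le_of_mem_stdSimplex {p u : 𝒜 → ℝ} (hp : p ∈ stdSimplex ℝ 𝒜) {M : ℝ}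
    (hu : ∀ A, u A ≤ M) : ∑ A, p A * u A ≤ M := by
  calc ∑ A, p A * u A ≤ ∑ A, p A * M :=
        Finset.sum_le_sum fun A _ => mul_le_mul_of_nonneg_left (hu A) (hp.1 A)
    _ = M := by rw [← Finset.sum_mul, hp.2, one_mul]

lemma diagonal_mem_budgetPlans {ℓ : 𝒜 → 𝒜 → ℝ} (hd : ∀ A, ℓ A A = 0) {r : ℝ} (hr : 0 ≤ r)
    {p : 𝒜 → ℝ} (hp : p ∈ stdSimplex ℝ 𝒜) [DecidableEq 𝒜] :
    (fun A A' => if A = A' then p A else 0) ∈ budgetPlans ℓ r p := by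
  refine ⟨fun A A' => ?_, fun A => by simp, ?_⟩
  · dsimp only
    split_ifs
    exacts [hp.1 A, le_rfl]
  · simpa [ite_mul, hd] using hr

/-- The second marginal of a budgeted plan lies in the Wasserstein ball. -/
lemma marginal_mem_ball {ℓ : 𝒜 → 𝒜 → ℝ} (hℓ : ∀ A A', 0 ≤ ℓ A A') {r : ℝ} {p : 𝒜 → ℝ}
    (hp : p ∈ stdSimplex ℝ 𝒜) {γ : 𝒜 → 𝒜 → ℝ} (hγ : γ ∈ budgetPlans ℓ r p) :
    (fun A' => ∑ A, γ A A') ∈ {q | q ∈ stdSimplex ℝ 𝒜 ∧ wassersteinDist ℓ p q ≤ r} := by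
  refine ⟨⟨fun A' => Finset.sum_nonneg fun A _ => hγ.1 A A', ?_⟩, ?_⟩
  · rw [Finset.sum_comm, ← hp.2]
    exact Finset.sum_congr rfl fun A _ => hγ.2.1 A
  · refine (csInf_le ?_ (Set.mem_image_of_mem _ ?_)).trans hγ.2.2
    · refine ⟨0, ?_⟩
      rintro _ ⟨η, hη, rfl⟩
      exact Finset.sum_nonneg fun A _ => Finset.sum_nonneg fun A' _ =>
        mul_nonneg (hη.1 A A') (hℓ A A')
    · exact ⟨hγ.1, hγ.2.1, fun _ => rfl⟩

/-- The infimum defining the Wasserstein distance is attained, by compactness. -/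
lemma exists_budgetPlan_of_mem_ball {ℓ : 𝒜 → 𝒜 → ℝ} {r : ℝ} {p q : 𝒜 → ℝ}
    (hp : p ∈ stdSimplex ℝ 𝒜) (hq : q ∈ stdSimplex ℝ 𝒜) (hpq : wassersteinDist ℓ p q ≤ r) :
    ∃ γ ∈ budgetPlans ℓ r p, ∀ A', ∑ A, γ A A' = q A' := by
  have hcl : IsClosed (transportPlans p q) := by
    simp only [transportPlans, Set.ofPred_and, Set.ofPred_forall]
    refine ((isClosed_iInter fun A => isClosed_iInter fun A' => ?_).inter
      ((isClosed_iInter fun A => ?_).inter (isClosed_iInter fun A' => ?_)))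
    · exact isClosed_le continuous_const (by fun_prop)
    · exact isClosed_eq (by fun_prop) continuous_const
    · exact isClosed_eq (by fun_prop) continuous_const
  have hsub : transportPlans p q ⊆ Set.Icc 0 (fun _ _ => 1) := by
    intro γ hγ
    refine ⟨fun A A' => hγ.1 A A', fun A A' => ?_⟩
    calc γ A A' ≤ ∑ B, γ A B :=
          Finset.single_le_sum (fun B _ => hγ.1 A B) (Finset.mem_univ A')
      _ = p A := hγ.2.1 A
      _ ≤ ∑ B, p B := Finset.single_le_sum (fun B _ => hp.1 B) (Finset.mem_univ A)
      _ = 1 := hp.2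
  have hne : (transportPlans p q).Nonempty := by
    refine ⟨fun A A' => p A * q A', fun A A' => mul_nonneg (hp.1 A) (hq.1 A'), fun A => ?_,
      fun A' => ?_⟩
    · rw [← Finset.mul_sum, hq.2, mul_one]
    · rw [← Finset.sum_mul, hp.2, one_mul]
  have hcont : Continuous (fun γ : 𝒜 → 𝒜 → ℝ => ∑ A, ∑ A', γ A A' * ℓ A A') := by fun_prop
  obtain ⟨γ, hγ, h⟩ := (isCompact_Icc.of_isClosed_subset hcl hsub).exists_sInf_image_eq hne
    hcont.continuousOn
  exact ⟨γ, ⟨hγ.1, hγ.2.1, h ▸ hpq⟩, hγ.2.2⟩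

lemma bddAbove_worstExp {ℓ : 𝒜 → 𝒜 → ℝ} {r : ℝ} {p : 𝒜 → ℝ} (u : 𝒜 → ℝ) :
    BddAbove ((fun q : 𝒜 → ℝ => ∑ A, q A * u A) ''
      {q | q ∈ stdSimplex ℝ 𝒜 ∧ wassersteinDist ℓ p q ≤ r}) := by
  refine ⟨∑ A, |u A|, ?_⟩
  rintro _ ⟨q, hq, rfl⟩
  exact sum_mul_le_of_mem_stdSimplex hq.1 fun A => (le_abs_self _).trans
    (Finset.single_le_sum (f := fun A => |u A|) (fun B _ => abs_nonneg (u B)) (Finset.mem_univ A))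

lemma sum_le_worstExp {ℓ : 𝒜 → 𝒜 → ℝ} (hℓ : ∀ A A', 0 ≤ ℓ A A') {r : ℝ} {p : 𝒜 → ℝ}
    (hp : p ∈ stdSimplex ℝ 𝒜) (u : 𝒜 → ℝ) {γ : 𝒜 → 𝒜 → ℝ} (hγ : γ ∈ budgetPlans ℓ r p) :
    ∑ A, ∑ A', γ A A' * u A' ≤ worstExp ℓ r p u := by
  refine le_csSup (bddAbove_worstExp u) ⟨_, marginal_mem_ball hℓ hp hγ, ?_⟩
  simp only [Finset.sum_mul]
  exact Finset.sum_comm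

lemma worstExp_le {ℓ : 𝒜 → 𝒜 → ℝ} (hℓ : ∀ A A', 0 ≤ ℓ A A') (hd : ∀ A, ℓ A A = 0) {r : ℝ}
    (hr : 0 ≤ r) {p : 𝒜 → ℝ} (hp : p ∈ stdSimplex ℝ 𝒜) {u : 𝒜 → ℝ} {b : ℝ}
    (hb : ∀ γ ∈ budgetPlans ℓ r p, ∑ A, ∑ A', γ A A' * u A' ≤ b) : worstExp ℓ r p u ≤ b := by
  classical
  refine csSup_le (Set.Nonempty.image _ ⟨_, marginal_mem_ball hℓ hp
    (diagonal_mem_budgetPlans hd hr hp)⟩) ?_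
  rintro _ ⟨q, hq, rfl⟩
  obtain ⟨γ, hγ, h⟩ := exists_budgetPlan_of_mem_ball hp hq.1 hq.2
  refine le_trans (le_of_eq ?_) (hb γ hγ)
  rw [Finset.sum_comm]
  exact Finset.sum_congr rfl fun A' _ => by rw [← h A', Finset.sum_mul]

lemma worstExp_le_add {ℓ : 𝒜 → 𝒜 → ℝ} (hℓ : ∀ A A', 0 ≤ ℓ A A') (hd : ∀ A, ℓ A A = 0) {r : ℝ}
    (hr : 0 ≤ r) {p : 𝒜 → ℝ} (hp : p ∈ stdSimplex ℝ 𝒜) {u v : 𝒜 → ℝ} {e : ℝ}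
    (h : ∀ A, u A ≤ v A + e) : worstExp ℓ r p u ≤ worstExp ℓ r p v + e := by
  refine worstExp_le hℓ hd hr hp fun γ hγ => ?_
  have h1 := sum_le_worstExp hℓ hp v hγ
  have h2 : ∑ A, ∑ A', γ A A' * u A' ≤ ∑ A, ∑ A', (γ A A' * v A' + γ A A' * e) :=
    Finset.sum_le_sum fun A _ => Finset.sum_le_sum fun A' _ => by
      rw [← mul_add]; exact mul_le_mul_of_nonneg_left (h A') (hγ.1 A A')
  have h3 : ∑ A, ∑ A', γ A A' * e = e := by
    simp only [← Finset.sum_mul, hγ.2.1, hp.2, one_mul]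
  simp only [Finset.sum_add_distrib, h3] at h2
  linarith

lemma worstExp_le_of_le {ℓ : 𝒜 → 𝒜 → ℝ} (hℓ : ∀ A A', 0 ≤ ℓ A A') (hd : ∀ A, ℓ A A = 0) {r : ℝ}
    (hr : 0 ≤ r) {p : 𝒜 → ℝ} (hp : p ∈ stdSimplex ℝ 𝒜) {u : 𝒜 → ℝ} {M : ℝ}
    (h : ∀ A, u A ≤ M) : worstExp ℓ r p u ≤ M := by
  refine worstExp_le hℓ hd hr hp fun γ hγ => ?_
  have h3 : ∑ A, ∑ A', γ A A' * M = M := by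
    simp only [← Finset.sum_mul, hγ.2.1, hp.2, one_mul]
  rw [← h3]
  exact Finset.sum_le_sum fun A _ => Finset.sum_le_sum fun A' _ =>
    mul_le_mul_of_nonneg_left (h A') (hγ.1 A A')

lemma worstExp_nonneg {ℓ : 𝒜 → 𝒜 → ℝ} (hℓ : ∀ A A', 0 ≤ ℓ A A') (hd : ∀ A, ℓ A A = 0) {r : ℝ}
    (hr : 0 ≤ r) {p : 𝒜 → ℝ} (hp : p ∈ stdSimplex ℝ 𝒜) {u : 𝒜 → ℝ} (hu : ∀ A, 0 ≤ u A) :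
    0 ≤ worstExp ℓ r p u := by
  classical
  have hγ := diagonal_mem_budgetPlans hd hr hp
  exact (Finset.sum_nonneg fun A _ => Finset.sum_nonneg fun A' _ =>
    mul_nonneg (hγ.1 A A') (hu A')).trans (sum_le_worstExp hℓ hp u hγ)

/-- Weak duality. -/
lemma worstExp_le_lagrangian {ℓ : 𝒜 → 𝒜 → ℝ} (hℓ : ∀ A A', 0 ≤ ℓ A A') (hd : ∀ A, ℓ A A = 0)
    {r : ℝ} (hr : 0 ≤ r) {p : 𝒜 → ℝ} (hp : p ∈ stdSimplex ℝ 𝒜) (u : 𝒜 → ℝ) {y : ℝ} (hy : 0 ≤ y) :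
    worstExp ℓ r p u ≤ r * y + ∑ A, p A * lagrangian ℓ y u A := by
  refine worstExp_le hℓ hd hr hp fun γ hγ => ?_
  have h1 : ∑ A, ∑ A', γ A A' * u A' ≤
      ∑ A, ∑ A', (γ A A' * lagrangian ℓ y u A + y * (γ A A' * ℓ A A')) :=
    Finset.sum_le_sum fun A _ => Finset.sum_le_sum fun A' _ => by
      have := mul_le_mul_of_nonneg_left (sub_le_lagrangian ℓ y u A A') (hγ.1 A A')
      linarith
  simp only [Finset.sum_add_distrib, ← Finset.mul_sum, ← Finset.sum_mul, hγ.2.1] at h1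
  have h2 := mul_le_mul_of_nonneg_left hγ.2.2 hy
  linarith

/-- At radius `0` every multiplier that makes all moves of positive length unprofitable is
optimal. -/
lemma lagrangian_le_worstExp_of_radius_zero {ℓ : 𝒜 → 𝒜 → ℝ} (hℓ : ∀ A A', 0 ≤ ℓ A A')
    {p : 𝒜 → ℝ} (hp : p ∈ stdSimplex ℝ 𝒜) (hd : ∀ A, ℓ A A = 0) {u : 𝒜 → ℝ} {y M : ℝ}
    (hu0 : ∀ A, 0 ≤ u A) (hu : ∀ A, u A ≤ M) (hy : ∀ A A', 0 < ℓ A A' → M ≤ y * ℓ A A') :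
    ∑ A, p A * lagrangian ℓ y u A ≤ worstExp ℓ 0 p u := by
  classical
  have hex : ∀ A, ∃ A', ℓ A A' = 0 ∧ lagrangian ℓ y u A ≤ u A' := by
    intro A
    obtain ⟨A', h⟩ := exists_eq_lagrangian ℓ y u A
    rcases (hℓ A A').eq_or_lt with h0 | h0
    · exact ⟨A', h0.symm, by rw [← h, ← h0]; simp⟩
    · exact ⟨A, hd A, by linarith [hu A', hu0 A, hy A A' h0]⟩
  choose T hT0 hT using hex
  have hγ : (fun A A' => if T A = A' then p A else 0) ∈ budgetPlans ℓ 0 p := by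
    refine ⟨fun A A' => ?_, fun A => by simp, ?_⟩
    · dsimp only
      split_ifs
      exacts [hp.1 A, le_rfl]
    · simp [ite_mul, hT0]
  refine le_trans ?_ (sum_le_worstExp hℓ hp u hγ)
  refine Finset.sum_le_sum fun A _ => ?_
  simpa [ite_mul] using mul_le_mul_of_nonneg_left (hT A) (hp.1 A)

/-- Strong duality for a positive radius: a multiplier exists because the slopes from plans within
the budget dominate the slopes to plans beyond it (mix two such plans to meet the budget
exactly). -/
lemma exists_lagrangian_le_of_radius_pos {ℓ : 𝒜 → 𝒜 → ℝ} (hℓ : ∀ A A', 0 ≤ ℓ A A')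
    (hd : ∀ A, ℓ A A = 0) {r : ℝ} (hr : 0 < r) {p : 𝒜 → ℝ} (hp : p ∈ stdSimplex ℝ 𝒜) (u : 𝒜 → ℝ) :
    ∃ y, 0 ≤ y ∧ r * y + ∑ A, p A * lagrangian ℓ y u A ≤ worstExp ℓ r p u := by
  classical
  set L := worstExp ℓ r p u with hL
  let cst : (𝒜 → 𝒜 → ℝ) → ℝ := fun γ => ∑ A, ∑ A', γ A A' * ℓ A A'
  let val : (𝒜 → 𝒜 → ℝ) → ℝ := fun γ => ∑ A, ∑ A', γ A A' * u A'
  let Pl : Set (𝒜 → 𝒜 → ℝ) := {γ | (∀ A A', 0 ≤ γ A A') ∧ (∀ A, ∑ A', γ A A' = p A)}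
  have hval : ∀ γ ∈ Pl, cst γ ≤ r → val γ ≤ L := fun γ hγ hc =>
    sum_le_worstExp hℓ hp u ⟨hγ.1, hγ.2, hc⟩
  -- a mixture of two plans that meets the budget has value at most `L`
  have hmix : ∀ γ₁ ∈ Pl, ∀ γ₂ ∈ Pl, ∀ a b : ℝ, 0 ≤ a → 0 ≤ b → a + b = 1 →
      a * cst γ₁ + b * cst γ₂ ≤ r → a * val γ₁ + b * val γ₂ ≤ L := by
    intro γ₁ h₁ γ₂ h₂ a b ha hb hab hc
    have hlin : ∀ w : 𝒜 → 𝒜 → ℝ, ∑ A, ∑ A', (a * γ₁ A A' + b * γ₂ A A') * w A A' =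
        a * (∑ A, ∑ A', γ₁ A A' * w A A') + b * ∑ A, ∑ A', γ₂ A A' * w A A' := by
      intro w
      simp only [Finset.mul_sum, ← Finset.sum_add_distrib]
      exact Finset.sum_congr rfl fun A _ => Finset.sum_congr rfl fun A' _ => by ring
    have := hval (fun A A' => a * γ₁ A A' + b * γ₂ A A')
      ⟨fun A A' => add_nonneg (mul_nonneg ha (h₁.1 A A')) (mul_nonneg hb (h₂.1 A A')), fun A => by
        rw [Finset.sum_add_distrib, ← Finset.mul_sum, ← Finset.mul_sum, h₁.2, h₂.2, ← add_mul,
          hab, one_mul]⟩ ((hlin ℓ).trans_le hc)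
    exact (hlin fun _ A' => u A').symm.trans_le this
  let s : Set ℝ := insert 0 ((fun γ => (val γ - L) / (cst γ - r)) '' {γ | γ ∈ Pl ∧ r < cst γ})
  let t : Set ℝ := (fun γ => (L - val γ) / (r - cst γ)) '' {γ | γ ∈ Pl ∧ cst γ < r}
  have hdiag := diagonal_mem_budgetPlans hd le_rfl hp
  have hst : ∀ a ∈ s, ∀ b ∈ t, a ≤ b := by
    rintro a (rfl | ⟨γ₁, ⟨h₁, hc₁⟩, rfl⟩) b ⟨γ₂, ⟨h₂, hc₂⟩, rfl⟩
    · exact div_nonneg (sub_nonneg.2 (hval γ₂ h₂ hc₂.le)) (sub_nonneg.2 hc₂.le)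
    · have hc : 0 < cst γ₁ - cst γ₂ := by linarith
      have h := hmix γ₁ h₁ γ₂ h₂ ((r - cst γ₂) / (cst γ₁ - cst γ₂))
        ((cst γ₁ - r) / (cst γ₁ - cst γ₂)) (div_nonneg (by linarith) hc.le)
        (div_nonneg (by linarith) hc.le) (by rw [← add_div, div_eq_one_iff_eq hc.ne']; ring)
        (le_of_eq (by field_simp; ring))
      have h' : (r - cst γ₂) * val γ₁ + (cst γ₁ - r) * val γ₂ ≤ L * (cst γ₁ - cst γ₂) := by
        rw [← div_le_iff₀ hc]
        refine le_trans (le_of_eq ?_) h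
        field_simp
      dsimp only
      rw [div_le_div_iff₀ (by linarith) (by linarith)]
      linarith
  obtain ⟨y, hys, hyt⟩ := exists_between_of_forall_le (s := s) (t := t) ⟨0, Or.inl rfl⟩
    ⟨_, _, ⟨⟨hdiag.1, hdiag.2.1⟩, hdiag.2.2.trans_lt hr⟩, rfl⟩ hst
  have hslope : ∀ γ ∈ Pl, val γ - y * cst γ ≤ L - r * y := by
    intro γ hγ
    rcases lt_trichotomy (cst γ) r with h | h | h
    · have := hyt (Set.mem_image_of_mem _ ⟨hγ, h⟩)
      rw [le_div_iff₀ (by linarith)] at this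
      linarith
    · rw [h]; linarith [hval γ hγ h.le]
    · have := hys (Or.inr (Set.mem_image_of_mem _ ⟨hγ, h⟩))
      rw [div_le_iff₀ (by linarith)] at this
      linarith
  refine ⟨y, hys (Or.inl rfl), ?_⟩
  -- the plan sending each scenario to a maximiser of its Lagrangian attains the dual value
  choose T hT using exists_eq_lagrangian ℓ y u
  have h := hslope (fun A A' => if T A = A' then p A else 0)
    ⟨fun A A' => by dsimp only; split_ifs; exacts [hp.1 A, le_rfl], fun A => by simp⟩
  have h' : ∑ A, p A * lagrangian ℓ y u A =
      ∑ A, p A * u (T A) - y * ∑ A, p A * ℓ A (T A) := by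
    rw [Finset.mul_sum, ← Finset.sum_sub_distrib]
    exact Finset.sum_congr rfl fun A _ => by rw [← hT A]; ring
  simp only [val, cst, ite_mul, zero_mul, Finset.sum_ite_eq, Finset.mem_univ, if_true] at h
  linarith

/-- For a finite scenario set, some finite multiplier makes every move of positive length
unprofitable. -/
lemma exists_large_multiplier (ℓ : 𝒜 → 𝒜 → ℝ) {M : ℝ} (hM : 0 ≤ M) :
    ∃ y, 0 ≤ y ∧ ∀ A A', 0 < ℓ A A' → M ≤ y * ℓ A A' := by
  have h0 : ∀ A A', 0 ≤ M / |ℓ A A'| := fun A A' => div_nonneg hM (abs_nonneg _)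
  refine ⟨∑ A, ∑ A', M / |ℓ A A'|,
    Finset.sum_nonneg fun A _ => Finset.sum_nonneg fun A' _ => h0 A A', fun A A' h => ?_⟩
  rw [← div_le_iff₀ h]
  calc M / ℓ A A' = M / |ℓ A A'| := by rw [abs_of_pos h]
    _ ≤ ∑ B, M / |ℓ A B| := Finset.single_le_sum (fun B _ => h0 A B) (Finset.mem_univ A')
    _ ≤ _ := Finset.single_le_sum (f := fun A => ∑ B, M / |ℓ A B|)
      (fun B _ => Finset.sum_nonneg fun B' _ => h0 B B') (Finset.mem_univ A)

/-- Strong duality. -/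
lemma exists_lagrangian_le_worstExp {ℓ : 𝒜 → 𝒜 → ℝ} (hℓ : ∀ A A', 0 ≤ ℓ A A')
    (hd : ∀ A, ℓ A A = 0) {r : ℝ} (hr : 0 ≤ r) {p : 𝒜 → ℝ} (hp : p ∈ stdSimplex ℝ 𝒜) {u : 𝒜 → ℝ}
    (hu : ∀ A, 0 ≤ u A) :
    ∃ y, 0 ≤ y ∧ r * y + ∑ A, p A * lagrangian ℓ y u A ≤ worstExp ℓ r p u := by
  rcases hr.eq_or_lt with rfl | hr
  · obtain ⟨y, hy, h⟩ := exists_large_multiplier ℓ (M := ∑ A, u A)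
      (Finset.sum_nonneg fun A _ => hu A)
    refine ⟨y, hy, ?_⟩
    rw [zero_mul, zero_add]
    exact lagrangian_le_worstExp_of_radius_zero hℓ hp hd hu
      (fun A => Finset.single_le_sum (fun B _ => hu B) (Finset.mem_univ A)) h
  · exact exists_lagrangian_le_of_radius_pos hℓ hd hr hp u

/-- A finite set of multipliers, of size about `M / e` whatever `ℓ` and `r` are, suffices to
compare the worst-case expectations of `[0, M]`-valued functions around two distributions up to the
error `2 * e`. Rounding the multiplier `y` up decreases the Lagrangian and costs `r` times the
rounding error, so the multiples of `e / r` up to `M / r` form such a set; beyond `M / r` the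
dual value exceeds the trivial bound `M`. -/
lemma exists_multiplier_grid {ℓ : 𝒜 → 𝒜 → ℝ} (hℓ : ∀ A A', 0 ≤ ℓ A A') (hd : ∀ A, ℓ A A = 0)
    {r : ℝ} (hr : 0 ≤ r) {M e : ℝ} (hM : 0 ≤ M) (he : 0 < e) :
    ∃ Y : Finset ℝ, (Y.card : ℝ) ≤ M / e + 2 ∧ (∀ y ∈ Y, 0 ≤ y) ∧
      ∀ p ∈ stdSimplex ℝ 𝒜, ∀ q ∈ stdSimplex ℝ 𝒜, ∀ u : 𝒜 → ℝ, (∀ A, 0 ≤ u A) → (∀ A, u A ≤ M) →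
        (∀ y ∈ Y, ∑ A, p A * lagrangian ℓ y u A ≤ ∑ A, q A * lagrangian ℓ y u A + e) →
        worstExp ℓ r p u ≤ worstExp ℓ r q u + 2 * e := by
  rcases hr.eq_or_lt with rfl | hr0
  · obtain ⟨y, hy, h⟩ := exists_large_multiplier ℓ hM
    refine ⟨{y}, ?_, by simpa using hy, fun p hp q hq u hu0 hu hY => ?_⟩
    · simp only [Finset.card_singleton, Nat.cast_one]
      linarith [div_nonneg hM he.le]
    · have h1 := worstExp_le_lagrangian hℓ hd hr hp u hy
      have h2 := hY y (Finset.mem_singleton_self y)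
      have h3 := lagrangian_le_worstExp_of_radius_zero hℓ hq hd hu0 hu h
      linarith
  · refine ⟨(Finset.range (⌈M / e⌉₊ + 1)).image (fun i : ℕ => i * (e / r)), ?_, ?_, ?_⟩
    · have h1 : (((Finset.range (⌈M / e⌉₊ + 1)).image (fun i : ℕ => i * (e / r))).card : ℝ) ≤
          (⌈M / e⌉₊ + 1 : ℕ) := by
        exact_mod_cast Finset.card_image_le.trans (Finset.card_range _).le
      have h2 := (Nat.ceil_lt_add_one (div_nonneg hM he.le)).le
      push_cast at h1
      linarith
    · intro y hy
      obtain ⟨i, -, rfl⟩ := Finset.mem_image.1 hy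
      positivity
    · intro p hp q hq u hu0 hu hY
      obtain ⟨y, hy, h⟩ := exists_lagrangian_le_worstExp hℓ hd hr hq hu0
      have hlag0 : 0 ≤ ∑ A, q A * lagrangian ℓ y u A := Finset.sum_nonneg fun A _ =>
        mul_nonneg (hq.1 A) ((hu0 A).trans (le_lagrangian_self hd y u A))
      rcases le_total M (r * y) with hMy | hMy
      · have := worstExp_le_of_le hℓ hd hr hp hu
        linarith
      · set i := ⌈r * y / e⌉₊ with hi
        have hi1 : r * y ≤ i * e := by
          rw [← div_le_iff₀ he]; exact Nat.le_ceil _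
        have hi2 : i * e ≤ r * y + e := by
          have := (Nat.ceil_lt_add_one (div_nonneg (mul_nonneg hr hy) he.le)).le
          rw [← hi, ← sub_le_iff_le_add, le_div_iff₀ he] at this
          linarith
        have hiM : i ≤ ⌈M / e⌉₊ := Nat.ceil_mono (div_le_div_of_nonneg_right hMy he.le)
        have hmem : (i : ℝ) * (e / r) ∈
            (Finset.range (⌈M / e⌉₊ + 1)).image (fun i : ℕ => i * (e / r)) :=
          Finset.mem_image.2 ⟨i, Finset.mem_range.2 (Nat.lt_succ_of_le hiM), rfl⟩
        have h1 := worstExp_le_lagrangian hℓ hd hr hp u (y := i * (e / r)) (by positivity)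
        have h2 := hY _ hmem
        have hyi : y ≤ i * (e / r) := by
          rw [← mul_div_assoc, le_div_iff₀ hr0]; linarith
        have h3 : ∑ A, q A * lagrangian ℓ (i * (e / r)) u A ≤ ∑ A, q A * lagrangian ℓ y u A :=
          Finset.sum_le_sum fun A _ =>
            mul_le_mul_of_nonneg_left (lagrangian_anti hℓ hyi u A) (hq.1 A)
        have h4 : r * (i * (e / r)) = i * e := by field_simp
        linarith

end Duality

/-! ### Empirical distributions -/

section Sampling

variable {𝒜 : Type*} [Fintype 𝒜]

lemma sum_empirical_mul {N : ℕ} (a : Fin N → 𝒜) (u : 𝒜 → ℝ) :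
    ∑ A, empirical a A * u A = (∑ n, u (a n)) / N := by
  classical
  have h : ∀ A, empirical a A * u A = (∑ n, if a n = A then u A else 0) / N := by
    intro A
    rw [empirical, Nat.card_eq_fintype_card, Fintype.card_subtype, ← Finset.sum_filter,
      Finset.sum_const, nsmul_eq_mul]
    ring
  simp only [h, ← Finset.sum_div]
  rw [Finset.sum_comm]
  simp

lemma empirical_mem_stdSimplex {N : ℕ} (hN : 0 < N) (a : Fin N → 𝒜) :
    empirical a ∈ stdSimplex ℝ 𝒜 := by
  refine ⟨fun A => by unfold empirical; positivity, ?_⟩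
  have h := sum_empirical_mul a (fun _ => (1 : ℝ))
  have hN' : (N : ℝ) ≠ 0 := by positivity
  simpa [hN'] using h

variable [MeasurableSpace 𝒜] [MeasurableSingletonClass 𝒜] {Ω : Type*} [MeasurableSpace Ω]
  {μ : Measure Ω} [IsProbabilityMeasure μ]

lemma integral_comp_of_law {X : Ω → 𝒜} (hX : Measurable X) {p : 𝒜 → ℝ}
    (hp : ∀ A, μ.real (X ⁻¹' {A}) = p A) (u : 𝒜 → ℝ) :
    ∫ ω, u (X ω) ∂μ = ∑ A, p A * u A := by
  have hu : Measurable u := measurable_of_finite u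
  have : IsProbabilityMeasure (μ.map X) := Measure.isProbabilityMeasure_map hX.aemeasurable
  rw [← integral_map hX.aemeasurable hu.aestronglyMeasurable, integral_fintype .of_finite]
  refine Finset.sum_congr rfl fun A _ => ?_
  rw [map_measureReal_apply hX (measurableSet_singleton A), hp A, smul_eq_mul]

/-- Hoeffding's inequality for the lower tail of an empirical mean. -/
lemma measure_empirical_lt_le {N : ℕ} (hN : 0 < N) {X : Fin N → Ω → 𝒜} (hX : ∀ n, Measurable (X n))
    (hind : iIndepFun X μ) {p : 𝒜 → ℝ} (hp : ∀ n A, μ.real (X n ⁻¹' {A}) = p A) {u : 𝒜 → ℝ}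
    {M e : ℝ} (hM : 0 < M) (he : 0 ≤ e) (hu0 : ∀ A, 0 ≤ u A) (hu : ∀ A, u A ≤ M) :
    μ.real {ω | ∑ A, empirical (fun n => X n ω) A * u A + e < ∑ A, p A * u A} ≤
      exp (-(2 * N * e ^ 2 / M ^ 2)) := by
  have hum : Measurable u := measurable_of_finite u
  set E := ∑ A, p A * u A with hE
  let Y : Fin N → Ω → ℝ := fun n ω => (fun A => -u A) (X n ω) - ∫ ω, (fun A => -u A) (X n ω) ∂μ
  have hYint : ∀ n, ∫ ω, (fun A => -u A) (X n ω) ∂μ = -E := fun n => by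
    simp only [integral_neg, integral_comp_of_law (hX n) (hp n), hE]
  have hYind : iIndepFun Y μ :=
    hind.comp (fun n A => -u A - ∫ ω, (fun A => -u A) (X n ω) ∂μ)
      fun n => measurable_of_finite _
  have hsub : ∀ n ∈ Finset.univ, HasSubgaussianMGF (Y n) ((‖(0 : ℝ) - (-M)‖₊ / 2) ^ 2) μ :=
    fun n _ => hasSubgaussianMGF_of_mem_Icc ((hum.neg.comp (hX n)).aemeasurable)
      (Filter.Eventually.of_forall fun ω => ⟨neg_le_neg (hu _), neg_nonpos.2 (hu0 _)⟩)
  have hN' : (0 : ℝ) < N := by exact_mod_cast hN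
  have h := HasSubgaussianMGF.measure_sum_ge_le_of_iIndepFun hYind hsub
    (mul_nonneg hN'.le he)
  have hexp : -(N * e) ^ 2 / (2 * ((∑ _n : Fin N, (‖(0 : ℝ) - (-M)‖₊ / 2) ^ 2 : NNReal) : ℝ)) =
      -(2 * N * e ^ 2 / M ^ 2) := by
    simp only [zero_sub, neg_neg, Finset.sum_const, Finset.card_univ, Fintype.card_fin]
    push_cast
    rw [Real.norm_of_nonneg hM.le, nsmul_eq_mul]
    field_simp
  rw [hexp] at h
  refine (measureReal_mono ?_).trans h
  intro ω hω
  simp only [Set.mem_ofPred_eq, sum_empirical_mul] at hω ⊢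
  simp only [Y, hYint, Finset.sum_sub_distrib, Finset.sum_neg_distrib, Finset.sum_const,
    Finset.card_univ, Fintype.card_fin, nsmul_eq_mul]
  rw [← lt_sub_iff_add_lt, div_lt_iff₀ hN'] at hω
  linarith

/-- Events depending on disjoint batches of independent samples are independent. -/
lemma measure_biInter_batches {k N : ℕ} {S : Fin k → Fin N → Ω → 𝒜}
    (hS : ∀ i n, Measurable (S i n)) (hind : iIndepFun (fun t : Fin k × Fin N => S t.1 t.2) μ)
    (T : Fin k → Set (Fin N → 𝒜)) (s : Finset (Fin k)) :
    μ.real (⋂ i ∈ s, {ω | (fun n => S i n ω) ∈ T i}) =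
      ∏ i ∈ s, μ.real {ω | (fun n => S i n ω) ∈ T i} := by
  classical
  induction s using Finset.induction_on with
  | empty => simp
  | insert i s hi ih =>
    rw [Finset.prod_insert hi, ← ih, Finset.set_biInter_insert]
    have hdisj : Disjoint (({i} : Finset (Fin k)) ×ˢ (Finset.univ : Finset (Fin N)))
        (s ×ˢ (Finset.univ : Finset (Fin N))) := by
      rw [Finset.disjoint_left]
      rintro ⟨a, b⟩ h1 h2
      simp only [Finset.mem_product, Finset.mem_singleton, Finset.mem_univ, and_true] at h1 h2
      exact hi (h1 ▸ h2)
    have h := hind.indepFun_finset _ _ hdisj fun t => hS t.1 t.2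
    have h1 := h.measure_inter_preimage_eq_mul
      {w | (fun n => w ⟨(i, n), by simp⟩) ∈ T i}
      {w | ∀ a (ha : a ∈ s), (fun n => w ⟨(a, n), by simp [ha]⟩) ∈ T a}
      (Set.toFinite _).measurableSet (Set.toFinite _).measurableSet
    have h2 : (⋂ a ∈ s, {ω | (fun n => S a n ω) ∈ T a}) =
        {ω | ∀ a, a ∈ s → (fun n => S a n ω) ∈ T a} := by
      ext ω; simp
    rw [h2]
    simp only [Measure.real, ← ENNReal.toReal_mul]
    exact congrArg ENNReal.toReal h1

/-- Markov's inequality, amplified over `k` independent batches. -/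
lemma measure_forall_batches_le {k N : ℕ} (hN : 0 < N) {S : Fin k → Fin N → Ω → 𝒜}
    (hS : ∀ i n, Measurable (S i n)) (hind : iIndepFun (fun t : Fin k × Fin N => S t.1 t.2) μ)
    {p : 𝒜 → ℝ} (hp : ∀ i n A, μ.real (S i n ⁻¹' {A}) = p A) {u : 𝒜 → ℝ} (hu : ∀ A, 0 ≤ u A)
    {W ε : ℝ} (hW : 0 < W) (hε : 0 < ε) (huW : ∑ A, p A * u A ≤ W) :
    μ.real {ω | ∀ i, (1 + ε) * W ≤ ∑ A, empirical (fun n => S i n ω) A * u A} ≤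
      ((1 + ε)⁻¹) ^ k := by
  have hN' : (0 : ℝ) < N := by exact_mod_cast hN
  have hum : Measurable u := measurable_of_finite u
  have h1 : ∀ i, μ.real {ω | (1 + ε) * W ≤ ∑ A, empirical (fun n => S i n ω) A * u A} ≤
      (1 + ε)⁻¹ := by
    intro i
    have hint : ∀ n, Integrable (fun ω => u (S i n ω)) μ := fun n =>
      Integrable.of_mem_Icc 0 (∑ A, u A) (hum.comp (hS i n)).aemeasurable
        (Filter.Eventually.of_forall fun ω => ⟨hu _,
          Finset.single_le_sum (fun B _ => hu B) (Finset.mem_univ _)⟩)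
    have hE : ∫ ω, (∑ n, u (S i n ω)) / N ∂μ = ∑ A, p A * u A := by
      rw [integral_div, integral_finsetSum _ fun n _ => hint n]
      simp only [integral_comp_of_law (hS i _) (hp i _), Finset.sum_const, Finset.card_univ,
        Fintype.card_fin, nsmul_eq_mul]
      field_simp
    have h := mul_meas_ge_le_integral_of_nonneg (μ := μ) (f := fun ω => (∑ n, u (S i n ω)) / N)
      (Filter.Eventually.of_forall fun ω =>
        div_nonneg (Finset.sum_nonneg fun n _ => hu _) hN'.le)
      ((integrable_finsetSum _ fun n _ => hint n).div_const _) ((1 + ε) * W)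
    rw [hE] at h
    simp only [sum_empirical_mul]
    rw [← one_div, le_div_iff₀ (by linarith)]
    have h' := h.trans huW
    refine le_of_mul_le_mul_right (a := W) ?_ hW
    linarith
  have h2 := measure_biInter_batches hS hind
    (fun _ => {a | (1 + ε) * W ≤ ∑ A, empirical a A * u A}) Finset.univ
  have h3 : {ω | ∀ i, (1 + ε) * W ≤ ∑ A, empirical (fun n => S i n ω) A * u A} =
      ⋂ i ∈ Finset.univ, {ω | (fun n => S i n ω) ∈
        {a : Fin N → 𝒜 | (1 + ε) * W ≤ ∑ A, empirical a A * u A}} := by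
    ext ω; simp
  rw [h3, h2]
  exact (Finset.prod_le_prod (fun i _ => measureReal_nonneg) fun i _ => h1 i).trans_eq (by simp)

end Sampling

/-! ### A net in the feasible region -/

/-- A set of nonnegative vectors in a box of side `R` has a net with at most `(R / s + 1) ^ m`
points, given by one point in each occupied cell of the grid of side `s`. -/
lemma exists_net {m : ℕ} {P : Set (EuclideanSpace ℝ (Fin m))} (hP : ∀ x ∈ P, ∀ i, 0 ≤ x i)
    {R s : ℝ} (hs : 0 < s) (hR : ∀ x ∈ P, ∀ i, x i ≤ R) (hR0 : 0 ≤ R) :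
    ∃ X : Finset (EuclideanSpace ℝ (Fin m)), (X.card : ℝ) ≤ (R / s + 1) ^ m ∧ ↑X ⊆ P ∧
      ∀ x ∈ P, ∃ x' ∈ X, ‖x - x'‖ ≤ m * s := by
  classical
  let n := ⌊R / s⌋₊
  let cell : EuclideanSpace ℝ (Fin m) → Fin m → ℕ := fun x i => ⌊x i / s⌋₊
  let F : Finset (Fin m → ℕ) := Fintype.piFinset fun _ => Finset.range (n + 1)
  have hF : ∀ x ∈ P, cell x ∈ F := fun x hx => Fintype.mem_piFinset.2 fun i =>
    Finset.mem_range.2 (Nat.lt_succ_of_le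
      (Nat.floor_mono (div_le_div_of_nonneg_right (hR x hx i) hs.le)))
  have hrep : ∀ f : Fin m → ℕ, f ∈ F.filter (fun f => ∃ x ∈ P, cell x = f) →
      ∃ x, x ∈ P ∧ cell x = f := fun f hf => by simpa using (Finset.mem_filter.1 hf).2
  choose! rep hrepP hrepc using hrep
  refine ⟨(F.filter (fun f => ∃ x ∈ P, cell x = f)).image rep, ?_, ?_, ?_⟩
  · have h1 : ((F.filter (fun f => ∃ x ∈ P, cell x = f)).image rep).card ≤ (n + 1) ^ m := by
      refine Finset.card_image_le.trans ((Finset.card_filter_le _ _).trans ?_)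
      simp [F]
    have h2 : ((n : ℝ) + 1) ^ m ≤ (R / s + 1) ^ m := by
      gcongr
      exact Nat.floor_le (div_nonneg hR0 hs.le)
    exact le_trans (by exact_mod_cast h1) h2
  · intro x hx
    obtain ⟨f, hf, rfl⟩ := Finset.mem_image.1 (Finset.mem_coe.1 hx)
    exact hrepP f hf
  · intro x hx
    have hmem : cell x ∈ F.filter (fun f => ∃ x ∈ P, cell x = f) :=
      Finset.mem_filter.2 ⟨hF x hx, x, hx, rfl⟩
    refine ⟨rep (cell x), Finset.mem_image_of_mem _ hmem, ?_⟩
    have hcoord : ∀ i, |x i - rep (cell x) i| ≤ s := by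
      intro i
      have hc : ⌊rep (cell x) i / s⌋₊ = ⌊x i / s⌋₊ := congrFun (hrepc _ hmem) i
      have a1 := Nat.floor_le (div_nonneg (hP x hx i) hs.le)
      have a2 := (Nat.lt_floor_add_one (x i / s)).le
      have b1 := Nat.floor_le (div_nonneg (hP _ (hrepP _ hmem) i) hs.le)
      have b2 := (Nat.lt_floor_add_one (rep (cell x) i / s)).le
      rw [hc] at b1 b2
      rw [le_div_iff₀ hs] at a1 b1
      rw [div_le_iff₀ hs] at a2 b2
      rw [abs_le]
      constructor <;> linarith
    have hsq : ∑ i, ‖(x - rep (cell x)) i‖ ^ 2 ≤ (m * s) ^ 2 := by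
      calc ∑ i, ‖(x - rep (cell x)) i‖ ^ 2 ≤ ∑ _i : Fin m, s ^ 2 := by
            refine Finset.sum_le_sum fun i _ => ?_
            exact pow_le_pow_left₀ (norm_nonneg _) (hcoord i) 2
        _ = m * s ^ 2 := by simp
        _ ≤ (m * s) ^ 2 := by
            rw [mul_pow]
            gcongr
            exact_mod_cast Nat.le_self_pow two_ne_zero m
    rw [EuclideanSpace.norm_eq]
    exact Real.sqrt_le_iff.2 ⟨by positivity, hsq⟩

/-! ### The sample bound -/

lemma le_exp_posLog {x : ℝ} (hx : 0 ≤ x) : x ≤ exp (posLog x) := by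
  rcases hx.eq_or_lt with rfl | hx
  · exact (exp_pos _).le
  · calc x = exp (log x) := (exp_log hx).symm
      _ ≤ _ := exp_le_exp.2 (le_max_right _ _)

/-- The number of batches times the sizes of the two nets times the tail bound of Hoeffding's
inequality is at most the failure probability. Each of the three cardinalities is at most
`exp (4 * T ^ 2)`, where `T` is the base of the polynomial sample bound, while the exponent in the
tail bound is at least `N / (2 * T ^ 4)`, hence at least `11 * T ^ 2`. -/
lemma union_bound_le {m k N : ℕ} {lam R V K τ LB ε δ W nX nY : ℝ} (hlam : 1 ≤ lam) (hR : 0 < R)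
    (hV : 0 < V) (hV1 : V ≤ 1) (hK : 0 ≤ K) (hτ : 1 ≤ τ) (hLB : 0 < LB) (hε : 0 < ε)
    (hε3 : ε ≤ 1 / 3) (hδ : 0 < δ) (hδ1 : δ < 1) (hW : LB ≤ W)
    (hk : k = ⌈2 / ε * log (1 / δ)⌉₊)
    (hN : 22 * (lam / ε + posLog (τ * R / (V * LB)) + log (1 / δ) + m + posLog K) ^ 6 ≤ (N : ℝ))
    (hX0 : 0 ≤ nX) (hY0 : 0 ≤ nY)
    (hX : nX ≤ (R / (ε * W / ((K + 1) * (m + 1))) + 1) ^ m)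
    (hY : nY ≤ 2 * lam * W / ε / (ε * W) + 2) :
    k * nX * nY * exp (-(2 * N * (ε * W) ^ 2 / (2 * lam * W / ε) ^ 2)) ≤ δ := by
  have hW0 : 0 < W := hLB.trans_le hW
  have hlog : 0 < log (1 / δ) := log_pos (by rw [lt_div_iff₀ hδ]; linarith)
  set P1 := posLog (τ * R / (V * LB)) with hP1
  set P2 := posLog K with hP2
  have hP10 : 0 ≤ P1 := posLog_nonneg
  have hP20 : 0 ≤ P2 := posLog_nonneg
  have hm0 : (0 : ℝ) ≤ m := Nat.cast_nonneg m
  have hlε : 0 < lam / ε := by positivity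
  have hinv : 1 / ε ≤ lam / ε := div_le_div_of_nonneg_right hlam hε.le
  have hinv3 : 3 ≤ 1 / ε := by rw [le_div_iff₀ hε]; linarith
  set T := lam / ε + P1 + log (1 / δ) + m + P2 with hT
  have hT3 : 3 ≤ T := by linarith
  have hεT : 1 / ε ≤ T := by linarith
  have hT0 : 0 < T := by linarith
  have hlogT : log (1 / δ) ≤ T := by linarith only [hT, hlε, hP10, hP20, hm0]
  have hmT : (m : ℝ) ≤ T := by linarith only [hT, hlε, hP10, hP20, hlog]
  have hlamT : lam / ε ≤ T := by linarith only [hT, hP10, hP20, hlog, hm0]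
  have hsq : T ^ 2 = T * T := sq T
  have hTT : 3 * 3 ≤ T * T := mul_le_mul hT3 hT3 (by norm_num) hT0.le
  have hexp : 3 * T ^ 2 ≤ exp (3 * T ^ 2) := (by linarith [add_one_le_exp (3 * T ^ 2)])
  have hkT : (k : ℝ) ≤ exp (3 * T ^ 2) := by
    have h1 := (Nat.ceil_lt_add_one (a := 2 / ε * log (1 / δ)) (by positivity)).le
    rw [← hk] at h1
    have h2 : (1 / ε) * log (1 / δ) ≤ T * T :=
      mul_le_mul hεT hlogT hlog.le hT0.le
    have h3 : 2 / ε * log (1 / δ) = 2 * ((1 / ε) * log (1 / δ)) := by ring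
    linarith only [h1, h2, h3, hexp, hTT, hsq]
  have hYT : nY ≤ exp (3 * T ^ 2) := by
    have h1 : 2 * lam * W / ε / (ε * W) = 2 * ((lam / ε) * (1 / ε)) := by field_simp
    have h2 : (lam / ε) * (1 / ε) ≤ T * T :=
      mul_le_mul hlamT hεT (by positivity) hT0.le
    rw [h1] at hY
    linarith only [hY, h2, hexp, hTT, hsq]
  have hcell : R / (ε * W / ((K + 1) * (m + 1))) + 1 ≤ exp (4 * T) := by
    have h1 : R / W ≤ exp P1 := by
      refine le_trans ?_ (le_exp_posLog (by positivity))
      rw [div_le_div_iff₀ hW0 (by positivity)]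
      have hVLB : V * LB ≤ W := (mul_le_of_le_one_left hLB.le hV1).trans hW
      calc R * (V * LB) ≤ R * W := by gcongr
        _ ≤ (τ * R) * W := by gcongr; exact le_mul_of_one_le_left hR.le hτ
    have h2 : K + 1 ≤ exp (P2 + 1) := by
      have a1 := le_exp_posLog hK
      have a2 : 1 ≤ exp P2 := one_le_exp hP20
      have a3 := add_one_le_exp (1 : ℝ)
      rw [exp_add]
      rw [← hP2] at a1
      nlinarith only [a1, a2, a3]
    have h3 : (m : ℝ) + 1 ≤ exp m := add_one_le_exp _
    have h4 : 1 / ε ≤ exp T := by linarith [add_one_le_exp T]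
    have h5 : R / (ε * W / ((K + 1) * (m + 1))) =
        (R / W) * (K + 1) * (m + 1) * (1 / ε) := by field_simp
    have h6 : (R / W) * (K + 1) * (m + 1) * (1 / ε) ≤
        exp P1 * exp (P2 + 1) * exp m * exp T := by gcongr
    rw [← exp_add, ← exp_add, ← exp_add] at h6
    have h7 : exp (P1 + (P2 + 1) + m + T) ≤ exp (3 * T) := exp_le_exp.2 (by
      linarith only [hT, hlog, hinv3, hinv, hT3])
    have h8 : exp (4 * T) = exp (3 * T) * exp T := by rw [← exp_add]; ring_nf
    have h9 : 1 ≤ exp (3 * T) := one_le_exp (by linarith)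
    have h10 := add_one_le_exp T
    rw [h5, h8]
    nlinarith only [h6, h7, h9, h10, hT3]
  have hXT : nX ≤ exp (4 * T ^ 2) := by
    calc nX ≤ _ := hX
      _ ≤ exp (4 * T) ^ m := by gcongr
      _ = exp (m * (4 * T)) := (exp_nat_mul _ _).symm
      _ ≤ exp (4 * T ^ 2) := exp_le_exp.2 (by
          have : (m : ℝ) * T ≤ T * T := mul_le_mul_of_nonneg_right hmT hT0.le
          linarith only [this, hsq])
  have hNT : 10 * T ^ 2 + T ≤ 2 * N * (ε * W) ^ 2 / (2 * lam * W / ε) ^ 2 := by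
    have h1 : 2 * N * (ε * W) ^ 2 / (2 * lam * W / ε) ^ 2 =
        N / (2 * ((lam / ε) ^ 2 * (1 / ε) ^ 2)) := by field_simp; try ring
    have h2 : (lam / ε) ^ 2 * (1 / ε) ^ 2 ≤ T ^ 2 * T ^ 2 := by
      gcongr
    rw [h1, le_div_iff₀ (by positivity)]
    have h3 : 10 * T ^ 2 + T ≤ 11 * T ^ 2 := by nlinarith only [hT3]
    calc (10 * T ^ 2 + T) * (2 * ((lam / ε) ^ 2 * (1 / ε) ^ 2))
        ≤ (11 * T ^ 2) * (2 * (T ^ 2 * T ^ 2)) := by gcongr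
      _ = 22 * T ^ 6 := by ring
      _ ≤ N := hN
  calc k * nX * nY * exp (-(2 * N * (ε * W) ^ 2 / (2 * lam * W / ε) ^ 2))
      ≤ exp (3 * T ^ 2) * exp (4 * T ^ 2) * exp (3 * T ^ 2) * exp (-(10 * T ^ 2 + T)) := by
        gcongr
    _ = exp (-T) := by rw [← exp_add, ← exp_add, ← exp_add]; ring_nf
    _ ≤ exp (-log (1 / δ)) := exp_le_exp.2 (by linarith only [hlogT])
    _ = δ := by rw [one_div, log_inv, neg_neg, exp_log hδ]

lemma inv_one_add_pow_le {ε δ : ℝ} (hε : 0 < ε) (hε1 : ε ≤ 1) (hδ : 0 < δ) {k : ℕ}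
    (hk : k = ⌈2 / ε * log (1 / δ)⌉₊) : ((1 + ε)⁻¹) ^ k ≤ δ := by
  have h1 : ε / 2 ≤ log (1 + ε) := by
    refine le_trans ?_ (one_sub_inv_le_log_of_pos (by linarith))
    have : 1 - (1 + ε)⁻¹ = ε / (1 + ε) := by field_simp; ring
    rw [this]
    exact div_le_div_of_nonneg_left hε.le (by linarith) (by linarith)
  have h2 : 2 / ε * log (1 / δ) ≤ k := hk ▸ Nat.le_ceil _
  have h3 : log (1 / δ) ≤ k * log (1 + ε) := by
    calc log (1 / δ) = (2 / ε * log (1 / δ)) * (ε / 2) := by field_simp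
      _ ≤ k * (ε / 2) := by gcongr
      _ ≤ k * log (1 + ε) := by gcongr
  rw [inv_pow]
  refine inv_le_of_inv_le₀ hδ ?_
  rw [← one_div, ← log_le_log_iff (by positivity) (by positivity), log_pow]
  exact h3

/-! ### Low and high scenarios -/

namespace Problem

variable {m : ℕ} {𝒜 : Type*}

/-- The recourse cost restricted to the low scenarios, those with `g(0, A) ≤ M`. -/
noncomputable def lowRecourse (Q : Problem m 𝒜) (M : ℝ) (x : EuclideanSpace ℝ (Fin m)) (A : 𝒜) :
    ℝ :=
  open Classical in if Q.recourse 0 A ≤ M then Q.recourse x A else 0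

namespace Admissible

variable {Q : Problem m 𝒜} {lam R V K τ : ℝ} (h : Q.Admissible lam R V K τ)

include h

lemma lowRecourse_nonneg {M : ℝ} {x : EuclideanSpace ℝ (Fin m)} (hx : x ∈ Q.feasible) (A : 𝒜) :
    0 ≤ Q.lowRecourse M x A := by
  unfold lowRecourse
  split_ifs
  exacts [h.recourse_nonneg x hx A, le_rfl]

lemma lowRecourse_le {M : ℝ} (hM : 0 ≤ M) {x : EuclideanSpace ℝ (Fin m)} (hx : x ∈ Q.feasible)
    (A : 𝒜) : Q.lowRecourse M x A ≤ M := by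
  unfold lowRecourse
  split_ifs with hA
  exacts [(h.recourse_le_zero x hx A).trans hA, hM]

lemma lowRecourse_le_recourse {M : ℝ} {x : EuclideanSpace ℝ (Fin m)} (hx : x ∈ Q.feasible)
    (A : 𝒜) : Q.lowRecourse M x A ≤ Q.recourse x A := by
  unfold lowRecourse
  split_ifs
  exacts [le_rfl, h.recourse_nonneg x hx A]

lemma bound_nonneg [Nonempty 𝒜] : 0 ≤ K := by
  obtain ⟨A⟩ := ‹Nonempty 𝒜›
  obtain ⟨s, -, hs⟩ := h.subgradient 0 h.zero_mem A
  exact (norm_nonneg s).trans hs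

lemma recourse_le_add {x x' : EuclideanSpace ℝ (Fin m)} (hx : x ∈ Q.feasible)
    (hx' : x' ∈ Q.feasible) (A : 𝒜) : Q.recourse x A ≤ Q.recourse x' A + K * ‖x - x'‖ := by
  obtain ⟨s, hs, hsK⟩ := h.subgradient x hx A
  have h1 := hs x' hx'
  have h2 : inner ℝ s (x - x') ≤ K * ‖x - x'‖ :=
    (real_inner_le_norm _ _).trans (mul_le_mul_of_nonneg_right hsK (norm_nonneg _))
  rw [← neg_sub, inner_neg_right] at h1
  linarith

lemma lowRecourse_le_add {x x' : EuclideanSpace ℝ (Fin m)} (hx : x ∈ Q.feasible)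
    (hx' : x' ∈ Q.feasible) (M : ℝ) {e : ℝ} (he : K * ‖x - x'‖ ≤ e) (he0 : 0 ≤ e) (A : 𝒜) :
    Q.lowRecourse M x A ≤ Q.lowRecourse M x' A + e := by
  unfold lowRecourse
  split_ifs
  · linarith [h.recourse_le_add hx hx' A]
  · linarith

lemma firstStage_nonneg {x : EuclideanSpace ℝ (Fin m)} (hx : x ∈ Q.feasible) :
    0 ≤ Q.firstStage x :=
  Finset.sum_nonneg fun i _ => mul_nonneg (h.cost_nonneg i) (h.feasible_nonneg x hx i)

variable [Fintype 𝒜]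

lemma objective_nonneg {p : 𝒜 → ℝ} (hp : p ∈ stdSimplex ℝ 𝒜) {x : EuclideanSpace ℝ (Fin m)}
    (hx : x ∈ Q.feasible) : 0 ≤ Q.objective p x :=
  add_nonneg (h.firstStage_nonneg hx)
    (worstExp_nonneg h.dist_nonneg h.dist_self h.radius_nonneg hp (h.recourse_nonneg x hx))

lemma optValue_le {p : 𝒜 → ℝ} (hp : p ∈ stdSimplex ℝ 𝒜) {x : EuclideanSpace ℝ (Fin m)}
    (hx : x ∈ Q.feasible) : Q.optValue p ≤ Q.objective p x :=
  csInf_le ⟨0, by rintro _ ⟨z, hz, rfl⟩; exact h.objective_nonneg hp hz⟩ ⟨x, hx, rfl⟩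

/-- High scenarios contribute at most `h(p; xs)` to the worst case at any decision `x`: by the
inflation property every transportation plan moves mass at most `ε / lam` to them, so replacing
`x` by `xs` there costs at most `ε cᵀ xs`. -/
lemma worstCase_le_lowRecourse {p : 𝒜 → ℝ} (hp : p ∈ stdSimplex ℝ 𝒜)
    {x xs : EuclideanSpace ℝ (Fin m)} (hx : x ∈ Q.feasible) (hxs : xs ∈ Q.feasible) {ε : ℝ}
    (hε : 0 < ε) (hε1 : ε ≤ 1) (hW : 0 < Q.objective p xs) :
    Q.worstCase p x ≤ worstExp Q.scenarioDist Q.radius p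
      (Q.lowRecourse (2 * lam * Q.objective p xs / ε) x) + Q.objective p xs := by
  classical
  set W := Q.objective p xs with hWdef
  set M := 2 * lam * W / ε with hM
  refine worstExp_le h.dist_nonneg h.dist_self h.radius_nonneg hp fun γ hγ => ?_
  let F : (𝒜 → ℝ) → ℝ := fun w => ∑ A, ∑ A', γ A A' * w A'
  have hmono : ∀ w w' : 𝒜 → ℝ, (∀ A, w A ≤ w' A) → F w ≤ F w' := fun w w' hw =>
    Finset.sum_le_sum fun A _ => Finset.sum_le_sum fun A' _ =>
      mul_le_mul_of_nonneg_left (hw A') (hγ.1 A A')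
  have hadd : ∀ w w' : 𝒜 → ℝ, F (fun A => w A + w' A) = F w + F w' := fun w w' => by
    simp only [F, mul_add, Finset.sum_add_distrib]
  have hsmul : ∀ (a : ℝ) (w : 𝒜 → ℝ), F (fun A => a * w A) = a * F w := fun a w => by
    simp only [F, Finset.mul_sum]
    exact Finset.sum_congr rfl fun A _ => Finset.sum_congr rfl fun A' _ => by ring
  let hi : 𝒜 → ℝ := fun A => if Q.recourse 0 A ≤ M then 0 else 1
  let v : 𝒜 → ℝ := fun A => if Q.recourse 0 A ≤ M then 0 else Q.recourse 0 A
  have hhi0 : 0 ≤ F hi := Finset.sum_nonneg fun A _ => Finset.sum_nonneg fun A' _ =>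
    mul_nonneg (hγ.1 A A') (by dsimp only [hi]; split_ifs <;> norm_num)
  set a := Q.firstStage xs with ha
  have ha0 : 0 ≤ a := h.firstStage_nonneg hxs
  have hlam := h.one_le_lam
  have h1 : F (fun A => Q.recourse x A) ≤ F (Q.lowRecourse M x) + F v := by
    rw [← hadd]
    refine hmono _ _ fun A => ?_
    dsimp only [v, lowRecourse]
    split_ifs
    · simp
    · simpa using h.recourse_le_zero x hx A
  have h2 : M * F hi ≤ F v := by
    rw [← hsmul]
    refine hmono _ _ fun A => ?_
    dsimp only [v, hi]
    split_ifs with hA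
    · simp
    · simpa using (not_le.1 hA).le
  have h3 : F v ≤ F (Q.recourse xs) + lam * a * F hi := by
    rw [← hsmul, ← hadd]
    refine hmono _ _ fun A => ?_
    dsimp only [v, hi]
    split_ifs
    · simpa using h.recourse_nonneg xs hxs A
    · simpa using h.inflation xs hxs A
  have h4 : F (Q.recourse xs) ≤ W - a := by
    have : F (Q.recourse xs) ≤ Q.worstCase p xs :=
      sum_le_worstExp h.dist_nonneg hp (Q.recourse xs) hγ
    rw [hWdef, objective]
    linarith
  have haW : a ≤ W := by
    have := worstExp_nonneg h.dist_nonneg h.dist_self h.radius_nonneg hp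
      (h.recourse_nonneg xs hxs)
    have h' : W = a + worstExp Q.scenarioDist Q.radius p (Q.recourse xs) := rfl
    linarith
  -- the mass `F hi` on high scenarios satisfies `lam * F hi ≤ ε`
  have h5 : lam * F hi ≤ ε := by
    have hMε : M * ε = 2 * lam * W := by rw [hM]; field_simp
    have hb0 : 0 ≤ lam * F hi := mul_nonneg (by linarith) hhi0
    have e1 : M * F hi ≤ W + lam * F hi * W := by nlinarith
    have e2 : 2 * (lam * F hi) * W ≤ (1 + lam * F hi) * ε * W := by
      calc 2 * (lam * F hi) * W = (M * F hi) * ε := by linear_combination (-F hi) * hMε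
        _ ≤ (W + lam * F hi * W) * ε := by gcongr
        _ = _ := by ring
    have e3 := le_of_mul_le_mul_right e2 hW
    nlinarith
  have h6 : F v ≤ W := by nlinarith
  have h7 : F (Q.lowRecourse M x) ≤ worstExp Q.scenarioDist Q.radius p (Q.lowRecourse M x) :=
    sum_le_worstExp h.dist_nonneg hp _ hγ
  exact h1.trans (by linarith)

/-- Comparison of the worst-case low recourse under two distributions, once the Lagrangians at the
points of a net `X` of decisions and of a set `Y` of multipliers are comparable. -/
lemma worstExp_lowRecourse_le {p q : 𝒜 → ℝ} (hp : p ∈ stdSimplex ℝ 𝒜) (hq : q ∈ stdSimplex ℝ 𝒜)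
    {M e : ℝ} (hM : 0 ≤ M) (he : 0 ≤ e) {X : Finset (EuclideanSpace ℝ (Fin m))} {Y : Finset ℝ}
    (hXP : ↑X ⊆ Q.feasible) (hX : ∀ x ∈ Q.feasible, ∃ x' ∈ X, K * ‖x - x'‖ ≤ e)
    (hY : ∀ p ∈ stdSimplex ℝ 𝒜, ∀ q ∈ stdSimplex ℝ 𝒜, ∀ u : 𝒜 → ℝ, (∀ A, 0 ≤ u A) →
      (∀ A, u A ≤ M) →
      (∀ y ∈ Y, ∑ A, p A * lagrangian Q.scenarioDist y u A ≤
        ∑ A, q A * lagrangian Q.scenarioDist y u A + e) →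
      worstExp Q.scenarioDist Q.radius p u ≤ worstExp Q.scenarioDist Q.radius q u + 2 * e)
    (hXY : ∀ x ∈ X, ∀ y ∈ Y,
      ∑ A, p A * lagrangian Q.scenarioDist y (Q.lowRecourse M x) A ≤
        ∑ A, q A * lagrangian Q.scenarioDist y (Q.lowRecourse M x) A + e)
    {x : EuclideanSpace ℝ (Fin m)} (hx : x ∈ Q.feasible) :
    worstExp Q.scenarioDist Q.radius p (Q.lowRecourse M x) ≤ Q.worstCase q x + 4 * e := by
  obtain ⟨x', hx'X, hxx'⟩ := hX x hx
  have hx' : x' ∈ Q.feasible := hXP hx'X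
  have h1 := worstExp_le_add h.dist_nonneg h.dist_self h.radius_nonneg hp
    (h.lowRecourse_le_add hx hx' M hxx' he)
  have h2 := hY p hp q hq (Q.lowRecourse M x') (h.lowRecourse_nonneg hx')
    (h.lowRecourse_le hM hx') (hXY x' hx'X)
  have h3 := worstExp_le_add h.dist_nonneg h.dist_self h.radius_nonneg hq
    (h.lowRecourse_le_add hx' hx M (by rwa [norm_sub_rev]) he)
  have h4 : worstExp Q.scenarioDist Q.radius q (Q.lowRecourse M x) ≤ Q.worstCase q x + 0 :=
    worstExp_le_add h.dist_nonneg h.dist_self h.radius_nonneg hq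
      fun A => by simpa using h.lowRecourse_le_recourse hx A
  linarith

end Admissible

end Problem

/-! ### Sample-average approximation -/

open Problem in
/-- With high probability the objective at the true distribution is bounded, uniformly over the
feasible region, by the empirical objective of each batch plus `(1 + 4 ε) h(p; xs)`. -/
lemma measure_not_forall_objective_le {m : ℕ} {𝒜 : Type*} [Fintype 𝒜] [MeasurableSpace 𝒜]
    [MeasurableSingletonClass 𝒜] {Q : Problem m 𝒜} {lam R V K τ LB ε δ : ℝ}
    (h : Q.Admissible lam R V K τ) (hLB : 0 < LB) (hε : 0 < ε) (hε3 : ε ≤ 1 / 3) (hδ : 0 < δ)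
    (hδ1 : δ < 1) {k N : ℕ} (hk : k = ⌈2 / ε * log (1 / δ)⌉₊)
    (hN : 22 * (lam / ε + posLog (τ * R / (V * LB)) + log (1 / δ) + m + posLog K) ^ 6 ≤ (N : ℝ))
    (hN0 : 0 < N) {p : 𝒜 → ℝ} (hp : p ∈ stdSimplex ℝ 𝒜) {xs : EuclideanSpace ℝ (Fin m)}
    (hxs : xs ∈ Q.feasible) (hW : LB ≤ Q.objective p xs) {Ω : Type*} [MeasurableSpace Ω]
    {μ : Measure Ω} [IsProbabilityMeasure μ] {S : Fin k → Fin N → Ω → 𝒜}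
    (hS : ∀ i n, Measurable (S i n)) (hind : iIndepFun (fun t : Fin k × Fin N => S t.1 t.2) μ)
    (hlaw : ∀ i n A, μ.real (S i n ⁻¹' {A}) = p A) :
    μ.real {ω | ¬ ∀ i, ∀ x ∈ Q.feasible, Q.objective p x ≤
      Q.objective (empirical fun n => S i n ω) x + (1 + 4 * ε) * Q.objective p xs} ≤ δ := by
  classical
  have : Nonempty 𝒜 := nonempty_of_mem_stdSimplex hp
  have hK := h.bound_nonneg
  set W := Q.objective p xs with hWdef
  have hW0 : 0 < W := hLB.trans_le hW
  have hlam0 : 0 < lam := zero_lt_one.trans_le h.one_le_lam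
  have hM : 0 < 2 * lam * W / ε := by positivity
  have he : 0 < ε * W := by positivity
  have hR := h.R_pos
  obtain ⟨Y, hYcard, hY0, hY⟩ := exists_multiplier_grid h.dist_nonneg h.dist_self h.radius_nonneg
    hM.le he
  have hs : 0 < ε * W / ((K + 1) * (m + 1)) := by positivity
  obtain ⟨X, hXcard, hXP, hX⟩ := exists_net h.feasible_nonneg hs (R := R) (fun x hx i =>
    (le_abs_self _).trans ((PiLp.norm_apply_le x i).trans
      (mem_closedBall_zero_iff.1 (h.feasible_subset hx)))) hR.le
  have hXe : ∀ x ∈ Q.feasible, ∃ x' ∈ X, K * ‖x - x'‖ ≤ ε * W := by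
    intro x hx
    obtain ⟨x', hx', hxx'⟩ := hX x hx
    refine ⟨x', hx', ?_⟩
    calc K * ‖x - x'‖ ≤ (K + 1) * ((m + 1) * (ε * W / ((K + 1) * (m + 1)))) := by
          gcongr
          · linarith
          · exact hxx'.trans (by gcongr; linarith)
      _ = ε * W := by field_simp
  let lag : EuclideanSpace ℝ (Fin m) → ℝ → 𝒜 → ℝ := fun x y =>
    lagrangian Q.scenarioDist y (Q.lowRecourse (2 * lam * W / ε) x)
  let bad : Fin k × EuclideanSpace ℝ (Fin m) × ℝ → Set Ω := fun t =>
    {ω | ∑ A, empirical (fun n => S t.1 n ω) A * lag t.2.1 t.2.2 A + ε * W <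
      ∑ A, p A * lag t.2.1 t.2.2 A}
  let I : Finset (Fin k × EuclideanSpace ℝ (Fin m) × ℝ) := Finset.univ ×ˢ X ×ˢ Y
  have hsub : {ω | ¬ ∀ i, ∀ x ∈ Q.feasible, Q.objective p x ≤
      Q.objective (empirical fun n => S i n ω) x + (1 + 4 * ε) * W} ⊆ ⋃ t ∈ I, bad t := by
    intro ω hω
    by_contra hcon
    refine hω fun i x hx => ?_
    simp only [Set.mem_iUnion, not_exists] at hcon
    have h1 := h.worstCase_le_lowRecourse hp hx hxs hε (by linarith) hW0
    have h2 := h.worstExp_lowRecourse_le hp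
      (empirical_mem_stdSimplex hN0 fun n => S i n ω) hM.le he.le hXP hXe hY
      (fun x hx y hy => not_lt.1 (hcon (i, x, y)
        (Finset.mem_product.2 ⟨Finset.mem_univ _, Finset.mem_product.2 ⟨hx, hy⟩⟩))) hx
    rw [← hWdef] at h1
    unfold objective
    linarith
  have hbad : ∀ t ∈ I, μ.real (bad t) ≤
      exp (-(2 * N * (ε * W) ^ 2 / (2 * lam * W / ε) ^ 2)) := by
    rintro ⟨i, x, y⟩ ht
    simp only [I, Finset.mem_product, Finset.mem_univ, true_and] at ht
    have hx := hXP (Finset.mem_coe.2 ht.1)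
    have hinj : Function.Injective (fun n : Fin N => (i, n)) := fun a b hab => by simpa using hab
    have hindi : iIndepFun (S i) μ := hind.precomp (g := fun n : Fin N => (i, n)) hinj
    exact measure_empirical_lt_le hN0 (hS i) hindi (hlaw i) hM he.le
      (fun A => (h.lowRecourse_nonneg hx A).trans (le_lagrangian_self h.dist_self y _ A))
      (lagrangian_le h.dist_nonneg (hY0 y ht.2) (h.lowRecourse_le hM.le hx))
  calc μ.real _ ≤ μ.real (⋃ t ∈ I, bad t) := measureReal_mono hsub (measure_ne_top _ _)
    _ ≤ ∑ t ∈ I, μ.real (bad t) := measureReal_biUnion_finset_le _ _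
    _ ≤ I.card • exp (-(2 * N * (ε * W) ^ 2 / (2 * lam * W / ε) ^ 2)) :=
        Finset.sum_le_card_nsmul _ _ _ hbad
    _ = k * X.card * Y.card * exp (-(2 * N * (ε * W) ^ 2 / (2 * lam * W / ε) ^ 2)) := by
        simp only [I, Finset.card_product, Finset.card_univ, Fintype.card_fin, nsmul_eq_mul]
        push_cast
        ring
    _ ≤ δ := union_bound_le h.one_le_lam hR h.V_pos h.V_le_one hK h.one_le_tau hLB hε hε3 hδ hδ1
        hW hk hN (Nat.cast_nonneg _) (Nat.cast_nonneg _) hXcard hYcard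

open Problem in
/-- With high probability, in some batch the fixed decision `xs` costs little more than under the
true distribution: by duality the empirical objective at `xs` is at most the empirical mean of a
function whose expectation under `p` is `h(p; xs)`. -/
lemma measure_not_exists_objective_le {m : ℕ} {𝒜 : Type*} [Fintype 𝒜] [MeasurableSpace 𝒜]
    [MeasurableSingletonClass 𝒜] {Q : Problem m 𝒜} {lam R V K τ ε δ : ℝ}
    (h : Q.Admissible lam R V K τ) (hε : 0 < ε) (hε1 : ε ≤ 1) (hδ : 0 < δ)
    {k N : ℕ} (hk : k = ⌈2 / ε * log (1 / δ)⌉₊)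
    (hN0 : 0 < N) {p : 𝒜 → ℝ} (hp : p ∈ stdSimplex ℝ 𝒜) {xs : EuclideanSpace ℝ (Fin m)}
    (hxs : xs ∈ Q.feasible) (hW : 0 < Q.objective p xs) {Ω : Type*} [MeasurableSpace Ω]
    {μ : Measure Ω} [IsProbabilityMeasure μ] {S : Fin k → Fin N → Ω → 𝒜}
    (hS : ∀ i n, Measurable (S i n)) (hind : iIndepFun (fun t : Fin k × Fin N => S t.1 t.2) μ)
    (hlaw : ∀ i n A, μ.real (S i n ⁻¹' {A}) = p A) :
    μ.real {ω | ¬ ∃ i, Q.objective (empirical fun n => S i n ω) xs ≤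
      (1 + ε) * Q.objective p xs} ≤ δ := by
  obtain ⟨y, hy, hdual⟩ := exists_lagrangian_le_worstExp h.dist_nonneg h.dist_self
    h.radius_nonneg hp (h.recourse_nonneg xs hxs)
  have hc := h.firstStage_nonneg hxs
  have hr := h.radius_nonneg
  let u : 𝒜 → ℝ := fun A =>
    (Q.firstStage xs + Q.radius * y) + lagrangian Q.scenarioDist y (Q.recourse xs) A
  have hu0 : ∀ A, 0 ≤ u A := fun A => add_nonneg (add_nonneg hc (mul_nonneg hr hy))
    ((h.recourse_nonneg xs hxs A).trans (le_lagrangian_self h.dist_self y _ A))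
  have hu : ∀ q ∈ stdSimplex ℝ 𝒜, ∑ A, q A * u A = Q.firstStage xs + (Q.radius * y +
      ∑ A, q A * lagrangian Q.scenarioDist y (Q.recourse xs) A) := by
    intro q hq
    simp only [u, mul_add, Finset.sum_add_distrib, ← Finset.sum_mul, hq.2]
    ring
  have huW : ∑ A, p A * u A ≤ Q.objective p xs := by
    rw [hu p hp]
    exact add_le_add_right hdual _
  refine (measureReal_mono ?_).trans ((measure_forall_batches_le hN0 hS hind hlaw hu0 hW hε
    huW).trans (inv_one_add_pow_le hε hε1 hδ hk))
  intro ω hω i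
  by_contra hlt
  refine hω ⟨i, le_trans ?_ (not_le.1 hlt).le⟩
  have hq := empirical_mem_stdSimplex hN0 fun n => S i n ω
  rw [hu _ hq]
  exact add_le_add_right (worstExp_le_lagrangian h.dist_nonneg h.dist_self hr hq _ hy) _

end DRTwoStage

/-! ### The approximation guarantee -/

theorem mainTheorem10 :
    -- `C` is the constant of the `O(ε)` term; `B` and `D` are the constants of the sample bound
    ∃ (C B : ℝ) (D : ℕ), 0 < C ∧ 0 < B ∧
      ∀ (m : ℕ) (𝒜 : Type*) [Fintype 𝒜] [MeasurableSpace 𝒜] [MeasurableSingletonClass 𝒜]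
        (Q : DRTwoStage.Problem m 𝒜) (lam R V K τ LB ε δ : ℝ),
        Q.Admissible lam R V K τ →
        0 < LB →
        (∀ p ∈ stdSimplex ℝ 𝒜, LB ≤ Q.optValue p) →
        0 < ε → ε ≤ 1 / 3 → 0 < δ → δ < 1 →
        ∀ (k N : ℕ),
        k = ⌈2 / ε * Real.log (1 / δ)⌉₊ →
        -- `N` is at least a fixed polynomial in the listed parameters
        B * (lam / ε + Real.posLog (τ * R / (V * LB)) + Real.log (1 / δ)
              + m + Real.posLog K) ^ D ≤ (N : ℝ) →
        ∀ (p : 𝒜 → ℝ), p ∈ stdSimplex ℝ 𝒜 →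
        ∀ (Ω : Type*) [MeasurableSpace Ω] (μ : Measure Ω) [IsProbabilityMeasure μ]
          (S : Fin k → Fin N → Ω → 𝒜),
        -- the `k * N` samples are independent and each has law `p`
        (∀ i n, Measurable (S i n)) →
        iIndepFun (fun (t : Fin k × Fin N) => S t.1 t.2) μ →
        (∀ i n A, μ.real (S i n ⁻¹' {A}) = p A) →
        ∀ (β ρ : ℝ), 1 ≤ β → 1 ≤ ρ →
        -- solutions, estimates and the minimising index, all depending on the outcome `ω`
        ∀ (x : Fin k → Ω → EuclideanSpace ℝ (Fin m)) (f : Fin k → Ω → ℝ) (j : Ω → Fin k),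
        (∀ᵐ ω ∂μ, ∀ i, x i ω ∈ Q.feasible ∧
          Q.objective (DRTwoStage.empirical fun n => S i n ω) (x i ω) ≤ β * f i ω ∧
          f i ω ≤ ρ * Q.optValue (DRTwoStage.empirical fun n => S i n ω)) →
        (∀ᵐ ω ∂μ, ∀ i, f (j ω) ω ≤ f i ω) →
        1 - 3 * δ ≤
          μ.real {ω | Q.objective p (x (j ω) ω) ≤ 4 * β * ρ * (1 + C * ε) * Q.optValue p} := by
  refine ⟨1, 22, 6, one_pos, by norm_num, ?_⟩
  intro m 𝒜 _ _ _ Q lam R V K τ LB ε δ h hLB hopt hε hε3 hδ hδ1 k N hk hN p hp Ω _ μ _ S hS hind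
    hlaw β ρ hβ hρ x f j hxf hj
  have hN0 : 0 < N := by
    have h1 : 0 < lam / ε := div_pos (zero_lt_one.trans_le h.one_le_lam) hε
    have h2 : 0 < Real.log (1 / δ) := Real.log_pos (by rw [lt_div_iff₀ hδ]; linarith)
    have h3 : 0 ≤ Real.posLog (τ * R / (V * LB)) := Real.posLog_nonneg
    have h4 : 0 ≤ Real.posLog K := Real.posLog_nonneg
    have h5 : (0 : ℝ) < N := lt_of_lt_of_le (by positivity) hN
    exact_mod_cast h5
  have hZ : 0 < Q.optValue p := hLB.trans_le (hopt p hp)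
  obtain ⟨_, ⟨xs, hxs, rfl⟩, hxsZ⟩ := exists_lt_of_csInf_lt
    (⟨_, 0, h.zero_mem, rfl⟩ : (Q.objective p '' Q.feasible).Nonempty)
    (show sInf (Q.objective p '' Q.feasible) < (1 + ε) * Q.optValue p from
      lt_mul_of_one_lt_left hZ (by linarith))
  have hWZ := h.optValue_le hp hxs
  set W := Q.objective p xs with hW
  have hW0 : 0 < W := hZ.trans_le hWZ
  have hA := DRTwoStage.measure_not_exists_objective_le h hε (by linarith) hδ hk hN0 hp hxs hW0
    hS hind hlaw
  have hB := DRTwoStage.measure_not_forall_objective_le h hLB hε hε3 hδ hδ1 hk hN hN0 hp hxs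
    ((hopt p hp).trans hWZ) hS hind hlaw
  set EA := {ω | ¬ ∃ i, Q.objective (DRTwoStage.empirical fun n => S i n ω) xs ≤ (1 + ε) * W}
  set EB := {ω | ¬ ∀ i, ∀ x ∈ Q.feasible, Q.objective p x ≤
    Q.objective (DRTwoStage.empirical fun n => S i n ω) x + (1 + 4 * ε) * W}
  set G := {ω | Q.objective p (x (j ω) ω) ≤ 4 * β * ρ * (1 + 1 * ε) * Q.optValue p}
  -- `G` need not be measurable; only outer measure and subadditivity are used below
  have hgood : ∀ᵐ ω ∂μ, ω ∈ G ∪ (EA ∪ EB) := by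
    filter_upwards [hxf, hj] with ω hω hjω
    by_cases hEA : ω ∈ EA
    · exact Or.inr (Or.inl hEA)
    by_cases hEB : ω ∈ EB
    · exact Or.inr (Or.inr hEB)
    left
    obtain ⟨i, hi⟩ := not_not.1 hEA
    have h1 := not_not.1 hEB (j ω) (x (j ω) ω) (hω (j ω)).1
    have h2 := (hω (j ω)).2.1
    have h3 := h.optValue_le
      (DRTwoStage.empirical_mem_stdSimplex hN0 fun n => S i n ω) hxs
    have h4 : f (j ω) ω ≤ ρ * ((1 + ε) * W) :=
      ((hjω i).trans (hω i).2.2).trans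
        (mul_le_mul_of_nonneg_left (h3.trans hi) (by linarith))
    have h5 : β * f (j ω) ω ≤ β * (ρ * ((1 + ε) * W)) :=
      mul_le_mul_of_nonneg_left h4 (by linarith)
    have hβρ : 1 ≤ β * ρ := one_le_mul_of_one_le_of_one_le hβ hρ
    have h6 : (1 + 4 * ε) * W ≤ β * ρ * ((1 + 4 * ε) * W) :=
      le_mul_of_one_le_left (by positivity) hβρ
    have h7 : (2 + 5 * ε) * W ≤ (2 + 5 * ε) * ((1 + ε) * Q.optValue p) := by gcongr
    -- `2 + 5 ε ≤ 4` because `ε ≤ 1 / 3`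
    have h8 : (2 + 5 * ε) * (1 + ε) ≤ 4 * (1 + ε) := by nlinarith only [hε, hε3]
    have h9 : (2 + 5 * ε) * W ≤ 4 * (1 + ε) * Q.optValue p := by
      linarith only [h7, mul_le_mul_of_nonneg_right h8 hZ.le]
    have h10 := mul_le_mul_of_nonneg_left h9 (by linarith : 0 ≤ β * ρ)
    change Q.objective p (x (j ω) ω) ≤ 4 * β * ρ * (1 + 1 * ε) * Q.optValue p
    linarith only [h1, h2, h5, h6, h10]
  have h1 : (1 : ℝ) ≤ μ.real (G ∪ (EA ∪ EB)) := by
    have : μ (G ∪ (EA ∪ EB)) = 1 :=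
      (measure_congr (Filter.eventuallyEq_univ.2 hgood)).trans measure_univ
    simp [Measure.real, this]
  have h2 := measureReal_union_le (μ := μ) G (EA ∪ EB)
  have h3 := measureReal_union_le (μ := μ) EA EB
  linarith only [h1, h2, h3, hA, hB, hδ]
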